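/- Logarithms are to the base $2$. A set $\mathcal X\subset\mathbb R^{d_x}$ is $\Delta$-separated if $\sup\|x-x'\|_2<\Delta\cdot\inf\|x-x'\|_2$, where the supremum and the infimum are over $x,x'\in\mathcal X$ with $x\ne x'$ (a one-point set counts as $\Delta$-separated). A function $\sigma:\mathbb R\to\mathbb R$ is sigmoidal if the limits $\lim_{x\to-\infty}\sigma(x)$ and $\lim_{x\to\infty}\sigma(x)$ exist and are different, and there is $z\in\mathbb R$ such that $\sigma$ is continuously differentiable at $z$ (differentiable near $z$, with derivative continuous at $z$) and $\sigma'(z)\neq0$. A $\sigma$ network with input dimension $d_x$, $k$ hidden layers and hidden layer dimensions $d_1,\dots,d_k$ is the family of functions $f_\theta=t_k\circ\sigma\circ\cdots\circ t_1\circ\sigma\circ t_0:\mathbb R^{d_x}\to\mathbb R$, where $t_\ell:\mathbb R^{d_\ell}\to\mathbb R^{d_{\ell+1}}$ are affine maps ($d_0=d_x$, $d_{k+1}=1$), $\sigma$ acts coordinatewise, and the parameter $\theta$ consists of all weights and biases of $t_0,\dots,t_k$; its width is $\max_{1\le\ell\le k} d_\ell$. The network can memorize the pairs $\{(x,y(x))\}_{x\in\mathcal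 X}$, where $y:\mathcal X\to\{0,\dots,C-1\}$, if for every $\varepsilon>0$ there is $\theta$ with $|f_\theta(x)-y(x)|\le\varepsilon$ for all $x\in\mathcal X$. **Theorem.** There are universal constants $c_1,c_2>0$ such that the following holds for all positive integers $C,N,d_x$, every real $\Delta\ge1$ and every sigmoidal $\sigma$. Put $$q:=\max\bigl\{1,\ \log d_x+\log\Delta+N^{2/3}\log C\bigr\}.$$ There is a $\sigma$ network architecture of input dimension $d_x$ and width $3$ (in fact with exactly three neurons in each hidden layer), whose number $k$ of hidden layers satisfies $c_1q\le k\le c_2q$, that can memorize every $\Delta$-separated set of $N$ pairs in dimension $d_x$ with $C$ classes, that is, $\{(x,y(x))\}_{x\in\mathcal X}$ for every $\Delta$-separated $\mathcal X\subset\mathbb R^{d_x}$ with $|\mathcal X|=N$ and every $y:\mathcal X\to\{0,\dots,C-1\}$. (If $C\ge2$, the maximum with $1$ is superfluous, so that $k=\Theta(\log d_x+\log\Delta+N^{2/3}\log C)$.) -/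

import Mathlib

open Filter Topology

/-- A set `X ⊆ ℝ^d` is `Δ`-separated if the supremum of the Euclidean distances between distinct
points is smaller than `Δ` times their infimum. Both are taken in `[0, ∞]`, so that the supremum is
`∞` for an unbounded set, and a set with at most one point (infimum `∞`) is `Δ`-separated for
every `Δ > 0`. -/
def IsDeltaSeparated {d : ℕ} (Δ : ℝ) (X : Set (EuclideanSpace ℝ (Fin d))) : Prop :=
  (⨆ (x ∈ X) (x' ∈ X) (_ : x ≠ x'), ‖x - x'‖ₑ) <
    ENNReal.ofReal Δ * ⨅ (x ∈ X) (x' ∈ X) (_ : x ≠ x'), ‖x - x'‖ₑ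

/-- Sigmoidal activation functions: both limits at `±∞` exist and they differ, and at some point
`z` the function is continuously differentiable (it is differentiable near `z` and its derivative is
continuous at `z`) with nonzero derivative. -/
def IsSigmoidal (σ : ℝ → ℝ) : Prop :=
  (∃ α β : ℝ, Tendsto σ atBot (𝓝 α) ∧ Tendsto σ atTop (𝓝 β) ∧ α ≠ β) ∧
  ∃ z : ℝ, (∀ᶠ x in 𝓝 z, DifferentiableAt ℝ σ x) ∧ ContinuousAt (deriv σ) z ∧ deriv σ z ≠ 0

/-- The weights and biases of an affine map `ℝ^m → ℝ^n`. -/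
structure AffineParams (m n : ℕ) where
  /-- the weights -/
  weight : Matrix (Fin n) (Fin m) ℝ
  /-- the biases -/
  bias : Fin n → ℝ

/-- The affine map `x ↦ W x + b`. -/
def AffineParams.apply {m n : ℕ} (t : AffineParams m n) (x : Fin m → ℝ) : Fin n → ℝ :=
  t.weight.mulVec x + t.bias

/-- The parameters `θ` of a fully connected feedforward network with input dimension `d`, hidden
layer dimensions given by the list (first hidden layer first), and output dimension `1`. -/
def NetParams : ℕ → List ℕ → Type
  | d, [] => AffineParams d 1
  | d, e :: ds => AffineParams d e × NetParams e ds

/-- The function `t_k ∘ σ ∘ ⋯ ∘ t_1 ∘ σ ∘ t_0` computed by the `σ` network with parameters `θ`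
(`k` is the number of hidden layers), where `σ` acts coordinatewise. -/
def netEval (σ : ℝ → ℝ) : (d : ℕ) → (ds : List ℕ) → NetParams d ds → (Fin d → ℝ) → ℝ
  | _, [], t, x => AffineParams.apply t x 0
  | _, e :: ds, θ, x => netEval σ e ds θ.2 (fun i => σ (θ.1.apply x i))

/-- The width of a network: the maximum of its hidden layer dimensions. -/
def netWidth (ds : List ℕ) : ℕ := ds.foldr max 0

/-- The `σ` network with input dimension `d` and hidden layer dimensions `ds` can memorize the pairs
`(x, y x)`, `x ∈ X`, with labels in `{0, …, C - 1}`: for every `ε > 0` some choice of the parameters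
fits all labels up to `ε`. -/
def CanMemorize (σ : ℝ → ℝ) {d C : ℕ} (ds : List ℕ) (X : Set (EuclideanSpace ℝ (Fin d)))
    (y : X → Fin C) : Prop :=
  ∀ ε : ℝ, 0 < ε → ∃ θ : NetParams d ds,
    ∀ x : X, |netEval σ d ds θ (fun i => x.1 i) - ((y x : ℕ) : ℝ)| ≤ ε

/-- The quantity `log d + log Δ + N^(2/3) log C`, with logarithms to the base `2`. -/
noncomputable def depthScale (C N d : ℕ) (Δ : ℝ) : ℝ :=
  Real.logb 2 d + Real.logb 2 Δ + (N : ℝ) ^ (2 / 3 : ℝ) * Real.logb 2 C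

/-! On finitely many inputs, a rescaled neuron approximates the identity (linearization at a point
where `σ'` is nonzero) or a threshold (steep scaling, by the two different limits). Passing to
closures makes both exact, so one layer of three neurons carries two numbers and computes one
threshold of an affine function of its three inputs (`Reach.step`).

A counting argument finds an integer functional that sends the points to a line with gaps at least 1
and total length O(N²d²Δ) (`IsDeltaSeparated.exists_projection`). The line is then folded: it is cut
into consecutive blocks, and each block is translated so that the images stay 1 apart
(`exists_fold`), at one layer per cut. A single cut nearly halves the length as long as it is well
above N², so O(1 + log d + log Δ) layers reach length O(N²), without a log N term. Blocks of at most
N^(1/3) points and of length N^(4/3) then need only O(N^(2/3)) cuts to reach length O(N^(4/3)).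

Finally the line is cut into O(N^(2/3)) blocks of about N^(2/3) unit cells, each cell holding at
most one point. A single number attached to a block encodes the labels of all its cells. Extracting
its bits one after another takes O(1) layers per bit, hence O(N^(2/3) log C) layers when C ≥ 2
(`exists_decode`, `exists_readout`). Spare layers act as the identity, so the depth can be padded.
-/

/-! ### Affine maps and limits of width-three networks -/

/-- The composition of two affine maps. -/
def AffineParams.comp {l m n : ℕ} (t : AffineParams m n) (s : AffineParams l m) :
    AffineParams l n :=
  ⟨t.weight * s.weight, t.weight.mulVec s.bias + t.bias⟩

theorem AffineParams.comp_apply {l m n : ℕ} (t : AffineParams m n) (s : AffineParams l m)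
    (x : Fin l → ℝ) : (t.comp s).apply x = t.apply (s.apply x) := by
  simp [AffineParams.comp, AffineParams.apply, Matrix.mulVec_add, add_assoc]

/-- The identity affine map. -/
def AffineParams.id (n : ℕ) : AffineParams n n := ⟨1, 0⟩

theorem AffineParams.id_apply {n : ℕ} (x : Fin n → ℝ) : (AffineParams.id n).apply x = x := by
  simp [AffineParams.id, AffineParams.apply]

theorem AffineParams.continuous_apply {m n : ℕ} (t : AffineParams m n) : Continuous t.apply := by
  unfold AffineParams.apply
  fun_prop

theorem exists_netEval_comp (σ : ℝ → ℝ) {l m : ℕ} (t : AffineParams l m) (ds : List ℕ)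
    (θ : NetParams m ds) :
    ∃ θ' : NetParams l ds, ∀ x, netEval σ l ds θ' x = netEval σ m ds θ (t.apply x) := by
  cases ds with
  | nil =>
    exact ⟨AffineParams.comp θ t, fun x => congrFun (AffineParams.comp_apply θ t x) 0⟩
  | cons e ds =>
    refine ⟨(AffineParams.comp θ.1 t, θ.2), fun x => ?_⟩
    change netEval σ e ds θ.2 (fun i => σ ((AffineParams.comp θ.1 t).apply x i)) = _
    rw [AffineParams.comp_apply]
    rfl

/-- The functions `X → ℝ³` computed by a network with `k` hidden layers of three neurons each and
three outputs, on the inputs `ξ x`. -/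
def layerOutputs (σ : ℝ → ℝ) {d : ℕ} {X : Type*} (ξ : X → Fin d → ℝ) : ℕ → Set (X → Fin 3 → ℝ)
  | 0 => {U | ∃ t : AffineParams d 3, U = fun x => t.apply (ξ x)}
  | k + 1 => {U | ∃ V ∈ layerOutputs σ ξ k, ∃ t : AffineParams 3 3,
      U = fun x => t.apply (fun i => σ (V x i))}

/-- `U` is a limit of functions computed by networks with `k` hidden layers of three neurons. -/
def Reach (σ : ℝ → ℝ) {d : ℕ} {X : Type*} (ξ : X → Fin d → ℝ) (k : ℕ) (U : X → Fin 3 → ℝ) : Prop :=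
  U ∈ closure (layerOutputs σ ξ k)

section Reach

variable {σ : ℝ → ℝ} {d : ℕ} {X : Type*} {ξ : X → Fin d → ℝ} {k : ℕ}

theorem affine_mem_layerOutputs (t : AffineParams 3 3) {U : X → Fin 3 → ℝ}
    (hU : U ∈ layerOutputs σ ξ k) : (fun x => t.apply (U x)) ∈ layerOutputs σ ξ k := by
  cases k with
  | zero =>
    obtain ⟨s, rfl⟩ := hU
    exact ⟨t.comp s, by simp [AffineParams.comp_apply]⟩
  | succ k =>
    obtain ⟨V, hV, s, rfl⟩ := hU
    exact ⟨V, hV, t.comp s, by simp [AffineParams.comp_apply]⟩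

theorem exists_netEval_of_mem_layerOutputs {U : X → Fin 3 → ℝ} (hU : U ∈ layerOutputs σ ξ k)
    (ds : List ℕ) (θ : NetParams 3 ds) :
    ∃ θ' : NetParams d (List.replicate k 3 ++ ds),
      ∀ x, netEval σ d _ θ' (ξ x) = netEval σ 3 ds θ (U x) := by
  induction k generalizing U ds with
  | zero =>
    obtain ⟨t, rfl⟩ := hU
    obtain ⟨θ', h⟩ := exists_netEval_comp σ t ds θ
    exact ⟨θ', fun x => h _⟩
  | succ k ih =>
    obtain ⟨V, hV, t, rfl⟩ := hU
    obtain ⟨θ₁, h₁⟩ := exists_netEval_comp σ t ds θ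
    have := ih hV (3 :: ds) (AffineParams.id 3, θ₁)
    rw [List.replicate_succ', List.append_assoc]
    obtain ⟨θ', h'⟩ := this
    refine ⟨θ', fun x => (h' x).trans ?_⟩
    rw [← h₁]
    change netEval σ 3 ds θ₁ (fun i => σ ((AffineParams.id 3).apply (V x) i)) = _
    rw [AffineParams.id_apply]

theorem Reach.affine {U : X → Fin 3 → ℝ} (h : Reach σ ξ k U) (t : AffineParams 3 3) :
    Reach σ ξ k (fun x => t.apply (U x)) := by
  refine map_mem_closure (f := fun (U : X → Fin 3 → ℝ) x => t.apply (U x)) ?_ h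
    fun V hV => affine_mem_layerOutputs t hV
  exact continuous_pi fun x => t.continuous_apply.comp (continuous_apply x)

theorem Reach.exists_netEval [Fintype X] {U : X → Fin 3 → ℝ} (h : Reach σ ξ k U) (i : Fin 3)
    {ε : ℝ} (hε : 0 < ε) :
    ∃ θ : NetParams d (List.replicate k 3),
      ∀ x, |netEval σ d (List.replicate k 3) θ (ξ x) - U x i| ≤ ε := by
  obtain ⟨V, hV, hd⟩ := Metric.mem_closure_iff.1 h ε hε
  have := exists_netEval_of_mem_layerOutputs hV []
    (⟨Matrix.of fun _ => Pi.single i 1, 0⟩ : AffineParams 3 1)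
  rw [List.append_nil] at this
  obtain ⟨θ, hθ⟩ := this
  refine ⟨θ, fun x => ?_⟩
  have hx : netEval σ d (List.replicate k 3) θ (ξ x) = V x i := by
    rw [hθ]
    change (⟨Matrix.of fun _ => Pi.single i 1, 0⟩ : AffineParams 3 1).apply (V x) 0 = _
    simp [AffineParams.apply, Matrix.mulVec]
  rw [hx, ← Real.dist_eq, dist_comm]
  exact ((dist_le_pi_dist _ _ i).trans (dist_le_pi_dist _ _ x)).trans hd.le

/-! ### What one neuron computes in the limit -/

/-- `v` is a limit of functions `x ↦ α σ(β u(x) + γ) + δ`, uniformly for small perturbations of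
`u`. -/
def ActivationLimit (σ : ℝ → ℝ) {X : Type*} (u v : X → ℝ) : Prop :=
  ∀ ε > 0, ∃ α β γ δ η : ℝ, 0 < η ∧
    ∀ x s, |s - u x| < η → |α * σ (β * s + γ) + δ - v x| < ε

/-- Near `z` the function `σ` is affine up to a relatively small error, and a small `β` squeezes the
bounded range of `u` into that neighbourhood. -/
theorem activationLimit_id [Finite X] (hσ : IsSigmoidal σ) (u : X → ℝ) :
    ActivationLimit σ u u := by
  intro ε hε
  obtain ⟨-, z, -, -, hz⟩ := hσ
  have hd : HasDerivAt σ (deriv σ z) z := (differentiableAt_of_deriv_ne_zero hz).hasDerivAt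
  obtain ⟨r, hr⟩ : ∃ r, ∀ x, |u x| ≤ r := by
    obtain ⟨r, hr⟩ := (Set.finite_range fun x => |u x|).bddAbove
    exact ⟨r, fun x => hr ⟨x, rfl⟩⟩
  set R := |r| + 1
  have hR : 0 < R := by positivity
  set D := deriv σ z
  have hD : 0 < |D| := abs_pos.2 hz
  have hlo := hasDerivAt_iff_isLittleO.1 hd
  have hc : 0 < ε * |D| / (4 * R) := by positivity
  obtain ⟨δ, hδ, hball⟩ := Metric.eventually_nhds_iff.1 (hlo.def hc)
  set β := δ / (2 * R)
  have hβ : 0 < β := by positivity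
  -- The linearization error and the perturbation of `u` contribute at most `ε / 4` each.
  refine ⟨1 / (β * D), β, z, -(σ z / (β * D)), min 1 (ε / 4), by positivity, fun x s hs => ?_⟩
  have hs1 : |s - u x| < 1 := hs.trans_le (min_le_left _ _)
  have hs2 : |s - u x| < ε / 4 := hs.trans_le (min_le_right _ _)
  have hsR : |s| ≤ R := by
    have : |s| ≤ |s - u x| + |u x| := by simpa using abs_add_le (s - u x) (u x)
    have := hr x
    have := le_abs_self r
    simp only [R]; linarith
  have hb := @hball (β * s + z) (by
    rw [Real.dist_eq, add_sub_cancel_right, abs_mul, abs_of_pos hβ]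
    calc β * |s| ≤ β * R := by gcongr
      _ = δ / 2 := by simp only [β]; field_simp
      _ < δ := by linarith)
  simp only [Real.norm_eq_abs, add_sub_cancel_right, smul_eq_mul] at hb
  have hkey : |(σ (β * s + z) - σ z - β * s * D) / (β * D)| ≤ ε / 4 := by
    rw [abs_div, div_le_iff₀ (by rw [abs_mul]; positivity)]
    refine hb.trans ?_
    rw [abs_mul, abs_mul, abs_of_pos hβ]
    calc ε * |D| / (4 * R) * (β * |s|) ≤ ε * |D| / (4 * R) * (β * R) := by gcongr
      _ = ε / 4 * (β * |D|) := by field_simp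
  have heq : 1 / (β * D) * σ (β * s + z) + -(σ z / (β * D)) - u x =
      (σ (β * s + z) - σ z - β * s * D) / (β * D) + (s - u x) := by
    have : D ≠ 0 := hz
    field_simp
    ring
  rw [heq]
  refine (abs_add_le _ _).trans_lt ?_
  linarith

-- A finite set has a positive gap between the values of `u` on `A` and off `A`. A steep enough
-- affine map sends the two sides of the gap to where `σ` is close to its two limits.
open Classical in
theorem activationLimit_indicator [Finite X] (hσ : IsSigmoidal σ) (u : X → ℝ) (A : Set X)
    (hA : ∀ x ∈ A, ∀ x' ∉ A, u x' < u x) :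
    ActivationLimit σ u (fun x => if x ∈ A then 1 else 0) := by
  obtain ⟨⟨a, b, ha, hb, hab⟩, -⟩ := hσ
  obtain ⟨θ, η, hη, h1, h0⟩ : ∃ θ η : ℝ, 0 < η ∧ (∀ x ∈ A, θ + 2 * η ≤ u x) ∧
      ∀ x ∉ A, u x ≤ θ - 2 * η := by
    cases isEmpty_or_nonempty X
    · exact ⟨0, 1, one_pos, fun x => isEmptyElim x, fun x => isEmptyElim x⟩
    obtain ⟨r, hr⟩ := (Set.finite_range fun x => |u x|).bddAbove
    have hr : ∀ x, |u x| ≤ r := fun x => hr ⟨x, rfl⟩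
    by_cases hAe : A.Nonempty
    · by_cases hBe : (Aᶜ).Nonempty
      · obtain ⟨x₁, hx₁, h₁⟩ := A.toFinite.exists_minimalFor u A hAe
        obtain ⟨x₂, hx₂, h₂⟩ := (Aᶜ).toFinite.exists_maximalFor u _ hBe
        have h := hA x₁ hx₁ x₂ hx₂
        -- A quarter of the gap: after a perturbation by `η`, a value is still at distance `η` from
        -- the threshold.
        refine ⟨(u x₁ + u x₂) / 2, (u x₁ - u x₂) / 4, by linarith, fun x hx => ?_, fun x hx => ?_⟩
        · have : u x₁ ≤ u x := by
            by_contra hlt; exact hlt (h₁ hx (not_le.1 hlt).le)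
          linarith
        · have : u x ≤ u x₂ := by
            by_contra hlt; exact hlt (h₂ hx (not_le.1 hlt).le)
          linarith
      · refine ⟨-r - 2, 1, one_pos, fun x _ => ?_, fun x hx => absurd ⟨x, hx⟩ hBe⟩
        have := neg_le_of_abs_le (hr x); linarith
    · refine ⟨r + 2, 1, one_pos, fun x hx => absurd ⟨x, hx⟩ hAe, fun x _ => ?_⟩
      have := le_of_abs_le (hr x); linarith
  intro ε hε
  have hba : 0 < |b - a| := abs_pos.2 (sub_ne_zero.2 hab.symm)
  have hne : b - a ≠ 0 := sub_ne_zero.2 hab.symm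
  have hc : 0 < ε * |b - a| := by positivity
  obtain ⟨m, hm⟩ := eventually_atBot.1 (Metric.tendsto_nhds.1 ha _ hc)
  obtain ⟨M, hM⟩ := eventually_atTop.1 (Metric.tendsto_nhds.1 hb _ hc)
  set T := max |m| |M|
  have hT : 0 ≤ T := (abs_nonneg m).trans (le_max_left _ _)
  refine ⟨1 / (b - a), T / η, -(T / η * θ), -(a / (b - a)), η, hη, fun x s hs => ?_⟩
  have harg : T / η * s + -(T / η * θ) = T / η * (s - θ) := by ring
  rw [harg]
  have hs' := abs_lt.1 hs
  by_cases hx : x ∈ A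
  · simp only [hx, if_true]
    have h2 : M ≤ T / η * (s - θ) := by
      have h3 : η ≤ s - θ := by linarith [h1 x hx]
      calc M ≤ T := (le_abs_self M).trans (le_max_right _ _)
        _ = T / η * η := by field_simp
        _ ≤ _ := by gcongr
    have h4 := hM _ h2
    rw [Real.dist_eq] at h4
    have : 1 / (b - a) * σ (T / η * (s - θ)) + -(a / (b - a)) - 1 =
        (σ (T / η * (s - θ)) - b) / (b - a) := by field_simp; ring
    rw [this, abs_div, div_lt_iff₀ hba]
    exact h4
  · simp only [hx, if_false]
    have h2 : T / η * (s - θ) ≤ m := by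
      have h3 : s - θ ≤ -η := by linarith [h0 x hx]
      calc T / η * (s - θ) ≤ T / η * (-η) := by gcongr
        _ = -T := by field_simp
        _ ≤ -|m| := neg_le_neg (le_max_left _ _)
        _ ≤ m := neg_abs_le m
    have h4 := hm _ h2
    rw [Real.dist_eq] at h4
    have : 1 / (b - a) * σ (T / η * (s - θ)) + -(a / (b - a)) - 0 =
        (σ (T / η * (s - θ)) - a) / (b - a) := by field_simp; ring
    rw [this, abs_div, div_lt_iff₀ hba]
    exact h4

theorem AffineParams.diagonal_apply {n : ℕ} (a b : Fin n → ℝ) (x : Fin n → ℝ) :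
    (⟨Matrix.diagonal a, b⟩ : AffineParams n n).apply x = fun i => a i * x i + b i := by
  ext i
  simp [AffineParams.apply, Matrix.mulVec_diagonal]

/-- The tolerance `η` in `ActivationLimit` absorbs the error made by the earlier layers, so limits
can be taken layer by layer. -/
theorem Reach.layer [Fintype X] {U V : X → Fin 3 → ℝ} (h : Reach σ ξ k U)
    (hV : ∀ i, ActivationLimit σ (fun x => U x i) (fun x => V x i)) : Reach σ ξ (k + 1) V := by
  refine Metric.mem_closure_iff.2 fun ε hε => ?_
  choose α β γ δ η hη hact using fun i => hV i ε hε
  have hη' : 0 < min (η 0) (min (η 1) (η 2)) := by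
    simp [hη]
  have hle : ∀ i, min (η 0) (min (η 1) (η 2)) ≤ η i := by
    intro i; fin_cases i <;> simp
  obtain ⟨U', hU', hd⟩ := Metric.mem_closure_iff.1 h _ hη'
  refine ⟨fun x i => α i * σ (β i * U' x i + γ i) + δ i,
    ⟨_, affine_mem_layerOutputs ⟨Matrix.diagonal β, γ⟩ hU', ⟨Matrix.diagonal α, δ⟩, ?_⟩, ?_⟩
  · funext x
    simp only [AffineParams.diagonal_apply]
  · rw [dist_pi_lt_iff hε]
    intro x
    rw [dist_pi_lt_iff hε]
    intro i
    rw [dist_comm, Real.dist_eq]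
    refine hact i x (U' x i) (lt_of_lt_of_le ?_ (hle i))
    rw [← Real.dist_eq, dist_comm]
    exact ((dist_le_pi_dist _ _ i).trans (dist_le_pi_dist _ _ x)).trans_lt hd

theorem Reach.mono [Fintype X] (hσ : IsSigmoidal σ) {U : X → Fin 3 → ℝ} (h : Reach σ ξ k U)
    {l : ℕ} (hl : k ≤ l) : Reach σ ξ l U := by
  induction l, hl using Nat.le_induction with
  | base => exact h
  | succ l _ ih => exact ih.layer fun i => activationLimit_id hσ _

theorem Reach.affine₃ {u v w : X → ℝ} (h : Reach σ ξ k (fun x => ![u x, v x, w x]))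
    (M : Matrix (Fin 3) (Fin 3) ℝ) (b : Fin 3 → ℝ) {u' v' w' : X → ℝ}
    (hu : ∀ x, M 0 0 * u x + M 0 1 * v x + M 0 2 * w x + b 0 = u' x)
    (hv : ∀ x, M 1 0 * u x + M 1 1 * v x + M 1 2 * w x + b 1 = v' x)
    (hw : ∀ x, M 2 0 * u x + M 2 1 * v x + M 2 2 * w x + b 2 = w' x) :
    Reach σ ξ k (fun x => ![u' x, v' x, w' x]) := by
  convert h.affine ⟨M, b⟩ using 2 with x
  ext i
  fin_cases i <;>
    simp [AffineParams.apply, Matrix.mulVec, dotProduct, Fin.sum_univ_three, ← hu, ← hv, ← hw]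

open Classical in
/-- One layer keeps the first two coordinates and replaces the third one by the indicator of a set
that an affine functional separates from its complement. -/
theorem Reach.step [Fintype X] (hσ : IsSigmoidal σ) {u v w : X → ℝ}
    (h : Reach σ ξ k (fun x => ![u x, v x, w x])) (a b c : ℝ) (A : Set X)
    (hA : ∀ x ∈ A, ∀ x' ∉ A, a * u x' + b * v x' + c * w x' < a * u x + b * v x + c * w x) :
    Reach σ ξ (k + 1) (fun x => ![u x, v x, if x ∈ A then 1 else 0]) := by
  have h' : Reach σ ξ k (fun x => ![u x, v x, a * u x + b * v x + c * w x]) :=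
    h.affine₃ !![1, 0, 0; 0, 1, 0; a, b, c] 0 (by simp) (by simp) (by simp)
  refine h'.layer fun i => ?_
  fin_cases i
  · exact activationLimit_id hσ u
  · exact activationLimit_id hσ v
  · exact activationLimit_indicator hσ _ A hA

end Reach

/-! ### Block-wise translation and bit extraction -/

section Machine

variable {σ : ℝ → ℝ} {d : ℕ} {X : Type*} {ξ : X → Fin d → ℝ} {k : ℕ}

theorem Reach.eq {U V : X → Fin 3 → ℝ} (h : Reach σ ξ k U) (hUV : U = V) : Reach σ ξ k V :=
  hUV ▸ h

/-- With one layer per block, one can add a function `E` of the block number to the second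
coordinate, and a multiple of the block number to the first one. -/
theorem Reach.add_block [Fintype X] (hσ : IsSigmoidal σ) {u v w : X → ℝ}
    (h : Reach σ ξ k (fun x => ![u x, v x, w x])) (c : ℝ) (κ : X → ℕ) (E : ℕ → ℝ)
    (hκ : ∀ x x' i, κ x ≤ i → i < κ x' → u x + c * κ x < u x' + c * i) (m : ℕ)
    (hm : ∀ x, κ x ≤ m) :
    Reach σ ξ (k + m) (fun x => ![u x + c * κ x, v x + E (κ x), 0]) := by
  classical
  -- After `i` layers every block beyond the `i`-th is treated like block `i`. The next threshold
  -- singles out the blocks beyond `i`, and they receive the increments `c` and `E (i + 1) - E i`.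
  have key : ∀ i : ℕ, Reach σ ξ (k + i)
      (fun x => ![u x + c * (min (κ x) i : ℕ), v x + E (min (κ x) i), 0]) := by
    intro i
    induction i with
    | zero =>
      exact h.affine₃ !![1, 0, 0; 0, 1, 0; 0, 0, 0] ![0, E 0, 0] (by simp) (by simp) (by simp)
    | succ i ih =>
      have h1 := ih.step hσ 1 0 0 {x | i < κ x} (by
        intro x hx x' hx'
        simp only [Set.mem_ofPred_eq, not_lt] at hx hx'
        have := hκ x' x i hx' hx
        rw [min_eq_right hx.le, min_eq_left hx']
        linarith)
      refine h1.affine₃ !![1, 0, c; 0, 1, E (i + 1) - E i; 0, 0, 0] 0 ?_ ?_ (by simp)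
      · intro x
        by_cases hx : i < κ x
        · simp [hx, min_eq_right hx.le]
          ring
        · have h1 : min (κ x) (i + 1) = κ x := min_eq_left (by omega)
          simp [hx, h1, min_eq_left (not_lt.1 hx)]
      · intro x
        by_cases hx : i < κ x
        · simp [hx, min_eq_right hx.le]
        · have h1 : min (κ x) (i + 1) = κ x := min_eq_left (by omega)
          simp [hx, h1, min_eq_left (not_lt.1 hx)]
  exact (key m).eq (by simp [hm])

open Classical in
/-- Bit extraction: a bounded function `e` of the block number encodes which of the `S i` contain
the block number, and `2 |s|` layers replace it by the sum of the weights of those `i` for which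
moreover the first coordinate is below `τ i`. -/
theorem exists_decode [Fintype X] (hσ : IsSigmoidal σ) {p : X → ℝ} (κ : X → ℕ) {ι : Type*}
    (weight τ : ι → ℝ) (S : ι → Set ℕ) (s : Finset ι) :
    ∀ W : ℝ, ∃ (e : ℕ → ℝ) (B : ℝ), (∀ n, |e n| ≤ B) ∧ ∀ (k : ℕ) (acc w : X → ℝ),
      (∀ x, |acc x| ≤ W) → Reach σ ξ k (fun x => ![p x, acc x + e (κ x), w x]) →
      Reach σ ξ (k + 2 * s.card)
        (fun x => ![p x,
          acc x + ∑ i ∈ s, weight i * if κ x ∈ S i ∧ p x < τ i then 1 else 0, 0]) := by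
  obtain ⟨P, hP⟩ : ∃ P, ∀ x, |p x| ≤ P := by
    obtain ⟨r, hr⟩ := (Set.finite_range fun x => |p x|).bddAbove
    exact ⟨r, fun x => hr ⟨x, rfl⟩⟩
  induction s using Finset.induction_on with
  | empty =>
    intro W
    refine ⟨0, 0, by simp, fun k acc w _ h => ?_⟩
    exact h.affine₃ !![1, 0, 0; 0, 1, 0; 0, 0, 0] 0 (by simp) (by simp) (by simp)
  | insert i s hi ih =>
    intro W
    obtain ⟨e, B, hB, hdec⟩ := ih (W + |weight i|)
    -- Since `acc + e` lies in `[-(W + B), W + B]`, adding `Λ` or not yields two separated ranges: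
    -- one threshold reads this leading digit, which is then subtracted.
    set Λ := 2 * (W + B) + 1
    refine ⟨fun n => e n + Λ * (if n ∈ S i then 1 else 0), B + |Λ|, fun n => ?_,
      fun k acc w hacc h => ?_⟩
    · refine (abs_add_le _ _).trans (add_le_add (hB n) ?_)
      split_ifs <;> simp
    · have h1 := h.step hσ 0 1 0 {x | κ x ∈ S i} (by
        intro x hx x' hx'
        simp only [Set.mem_ofPred_eq] at hx hx'
        have a1 := abs_le.1 (hacc x)
        have a2 := abs_le.1 (hacc x')
        have a3 := abs_le.1 (hB (κ x))
        have a4 := abs_le.1 (hB (κ x'))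
        simp only [hx, hx', if_true, if_false, Λ]
        linarith)
      have h2 : Reach σ ξ (k + 1)
          (fun x => ![p x, acc x + e (κ x), if κ x ∈ S i then (1 : ℝ) else 0]) :=
        h1.affine₃ !![1, 0, 0; 0, 1, -Λ; 0, 0, 1] 0 (by simp)
          (fun x => by simp only [Set.mem_ofPred_eq]; simp; split_ifs <;> ring) (by simp)
      -- The conjunction is one threshold: the weight `2 * P + 1` exceeds the oscillation of `p`, so
      -- the bit dominates and `-p` decides among points whose bit is 1.
      have h3 := h2.step hσ (-1) 0 (2 * P + 1) {x | κ x ∈ S i ∧ p x < τ i} (by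
        intro x hx x' hx'
        simp only [Set.mem_ofPred_eq] at hx hx'
        have a1 := abs_le.1 (hP x)
        have a2 := abs_le.1 (hP x')
        by_cases hS : κ x' ∈ S i
        · have : τ i ≤ p x' := not_lt.1 fun hlt => hx' ⟨hS, hlt⟩
          simp only [hS, hx.1, if_true]
          linarith [hx.2]
        · simp only [hS, hx.1, if_true, if_false]
          linarith)
      have h4 : Reach σ ξ (k + 2) (fun x => ![p x,
          (acc x + weight i * if κ x ∈ S i ∧ p x < τ i then 1 else 0) + e (κ x), 0]) :=
        h3.affine₃ !![1, 0, 0; 0, 1, weight i; 0, 0, 0] 0 (by simp)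
          (fun x => by simp only [Set.mem_ofPred_eq]; simp; split_ifs <;> ring) (by simp)
      have h5 := hdec (k + 2) _ _ (fun x => by
        refine (abs_add_le _ _).trans (add_le_add (hacc x) ?_)
        split_ifs <;> simp) h4
      rw [Finset.card_insert_of_notMem hi, show k + 2 * (s.card + 1) = k + 2 + 2 * s.card by ring]
      refine h5.eq ?_
      funext x
      rw [Finset.sum_insert hi, add_assoc]

theorem sum_testBit (y B : ℕ) (hy : y < 2 ^ B) :
    ∑ t ∈ Finset.range B, (2 : ℝ) ^ t * (if y.testBit t = true then 1 else 0) = y := by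
  have key : ∀ B, ∑ t ∈ Finset.range B, 2 ^ t * (if y.testBit t = true then 1 else 0)
      = y % 2 ^ B := by
    intro B
    induction B with
    | zero => simp [Nat.mod_one]
    | succ B ih =>
      rw [Finset.sum_range_succ, ih, Nat.mod_pow_succ]
      congr 2
      rw [Nat.testBit_eq_decide_div_mod_eq]
      have := Nat.mod_two_eq_zero_or_one (y / 2 ^ B)
      rcases this with h | h <;> simp [h]
  have := key B
  rw [Nat.mod_eq_of_lt hy] at this
  exact_mod_cast this

/-- Label readout: from the position `p ∈ [0, n)` inside a block and a code of the block, the label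
of the unit cell of `p` is recovered in `4 n B` layers. -/
theorem exists_readout [Fintype X] (hσ : IsSigmoidal σ) {p : X → ℝ} (κ : X → ℕ) (n B : ℕ)
    (hp0 : ∀ x, 0 ≤ p x) (hpn : ∀ x, p x < n) (Y : ℕ → ℕ → ℕ) (hY : ∀ i j, Y i j < 2 ^ B) :
    ∃ e : ℕ → ℝ, ∀ (k : ℕ) (w : X → ℝ),
      Reach σ ξ k (fun x => ![p x, e (κ x), w x]) →
      Reach σ ξ (k + 4 * n * B) (fun x => ![p x, Y (κ x) ⌊p x⌋₊, 0]) := by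
  classical
  -- The indices are cell `j`, bit `t` and a sign. The indicator of the cell is that of `p < j + 1`
  -- minus that of `p < j`, hence two items of two layers each per bit and cell.
  obtain ⟨e, -, -, he⟩ := exists_decode (ξ := ξ) hσ (p := p) κ (ι := (ℕ × ℕ) × Bool)
    (fun i => (bif i.2 then 1 else -1) * 2 ^ i.1.2) (fun i => (i.1.1 : ℝ) + bif i.2 then 1 else 0)
    (fun i => {b | (Y b i.1.1).testBit i.1.2 = true})
    ((Finset.range n ×ˢ Finset.range B) ×ˢ Finset.univ) 0
  refine ⟨e, fun k w h => ?_⟩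
  have h1 := he k 0 w (by simp) (h.eq (by simp))
  have hc : k + 2 * ((Finset.range n ×ˢ Finset.range B) ×ˢ (Finset.univ : Finset Bool)).card
      = k + 4 * n * B := by
    simp only [Finset.card_product, Finset.card_range, Finset.card_univ, Fintype.card_bool]
    ring
  rw [hc] at h1
  refine h1.eq ?_
  funext x
  congr 2
  rw [Finset.sum_product, Finset.sum_product]
  have hj : ∀ j ∈ Finset.range n, (∑ t ∈ Finset.range B, ∑ b : Bool,
      ((bif b then (1 : ℝ) else -1) * 2 ^ t) *
        (if κ x ∈ {b | (Y b j).testBit t = true} ∧ p x < (j : ℝ) + (bif b then 1 else 0)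
          then 1 else 0))
      = if ⌊p x⌋₊ = j then (Y (κ x) j : ℝ) else 0 := by
    intro j _
    have hfl : ⌊p x⌋₊ = j ↔ (j : ℝ) ≤ p x ∧ p x < j + 1 := Nat.floor_eq_iff (hp0 x)
    by_cases h0 : p x < j
    · have h2 : p x < (j : ℝ) + 1 := by linarith
      have h3 : ¬ ⌊p x⌋₊ = j := by rw [hfl]; intro h; linarith [h.1]
      rw [if_neg h3]
      refine Finset.sum_eq_zero fun t _ => ?_
      simp [h0, h2]
      split_ifs <;> simp
    · by_cases h2 : p x < (j : ℝ) + 1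
      · have h3 : ⌊p x⌋₊ = j := hfl.2 ⟨not_lt.1 h0, h2⟩
        rw [if_pos h3, ← sum_testBit _ B (hY (κ x) j)]
        refine Finset.sum_congr rfl fun t _ => ?_
        simp [h0, h2]
      · have h3 : ¬ ⌊p x⌋₊ = j := by rw [hfl]; intro h; exact h2 h.2
        rw [if_neg h3]
        refine Finset.sum_eq_zero fun t _ => ?_
        simp [h0, h2]
  have hmem : ⌊p x⌋₊ ∈ Finset.range n := by
    rw [Finset.mem_range, Nat.floor_lt (hp0 x)]; exact hpn x
  trans 0 + ∑ j ∈ Finset.range n, if ⌊p x⌋₊ = j then (Y (κ x) j : ℝ) else 0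
  · congr 1
    refine Finset.sum_congr rfl fun j hjn => ?_
    convert hj j hjn
  · rw [Finset.sum_ite_eq, if_pos hmem, zero_add]

end Machine

/-! ### Projection to the line -/

/-- For given `w`, let `j` be a coordinate of largest modulus. Two bad `u` that agree off `j` have
values differing by less than `|w j|`, so they coincide. At most `M ^ (d - 1)` of the `M ^ d`
candidates are thus bad for each `w`, and fewer than `M` vectors `w` cannot exclude all. -/
theorem exists_nat_functional {d : ℕ} (hd : 0 < d) (P : Finset (Fin d → ℝ)) (M : ℕ)
    (hP : P.card < M) :
    ∃ u : Fin d → ℕ, (∀ i, u i < M) ∧ ∀ w ∈ P, ∀ i, |w i| ≤ 2 * |∑ j, (u j : ℝ) * w j| := by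
  classical
  have : Nonempty (Fin d) := ⟨⟨0, hd⟩⟩
  set G : Finset (Fin d → ℕ) := Fintype.piFinset fun _ => Finset.range M
  have hG : G.card = M ^ d := by simp [G]
  set bad : (Fin d → ℝ) → Finset (Fin d → ℕ) := fun w =>
    G.filter fun u => ∃ i, 2 * |∑ j, (u j : ℝ) * w j| < |w i|
  have hbad : ∀ w, (bad w).card * M ≤ M ^ d := by
    intro w
    obtain ⟨j, hj⟩ := Finite.exists_max fun i => |w i|
    rw [← hG, ← Finset.card_range M, ← Finset.card_product]
    refine Finset.card_le_card_of_injOn (fun q => Function.update q.1 j q.2) ?_ ?_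
    · rintro ⟨u, s⟩ h
      simp only [Finset.coe_product, Set.mem_prod, Finset.mem_coe, bad, Finset.mem_filter,
        G, Fintype.mem_piFinset, Finset.mem_range] at h ⊢
      intro i
      by_cases hi : i = j
      · subst hi; simpa using h.2
      · simpa [hi] using h.1.1 i
    · rintro ⟨u, s⟩ h ⟨u', s'⟩ h' heq
      simp only [Finset.coe_product, Set.mem_prod, Finset.mem_coe, bad, Finset.mem_filter] at h h'
      simp only at heq
      have hs : s = s' := by simpa using congrFun heq j
      have hu : ∀ i, i ≠ j → u i = u' i := fun i hi => by simpa [hi] using congrFun heq i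
      obtain ⟨i, hi⟩ := h.1.2
      obtain ⟨i', hi'⟩ := h'.1.2
      have h1 := hi.trans_le (hj i)
      have h2 := hi'.trans_le (hj i')
      have hdiff : ∑ i, (u i : ℝ) * w i - ∑ i, (u' i : ℝ) * w i = ((u j : ℝ) - u' j) * w j := by
        rw [← Finset.sum_sub_distrib, Finset.sum_eq_single j]
        · ring
        · intro i _ hij; rw [hu i hij]; ring
        · simp
      have h3 : |(u j : ℝ) - u' j| * |w j| < 1 * |w j| := by
        rw [← abs_mul, ← hdiff]
        refine (abs_sub _ _).trans_lt ?_
        linarith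
      have h4 := lt_of_mul_lt_mul_right h3 (abs_nonneg _)
      have h5 : u j = u' j := by
        have : |(u j : ℤ) - u' j| < 1 := by exact_mod_cast h4
        have := Int.abs_lt_one_iff.1 this
        omega
      have : u = u' := by
        funext i
        by_cases hij : i = j
        · rw [hij, h5]
        · exact hu i hij
      rw [this, hs]
  have hM : 0 < M := by omega
  have hlt : (P.biUnion bad).card < G.card := by
    have h1 : (P.biUnion bad).card * M ≤ P.card * M ^ d := by
      calc (P.biUnion bad).card * M ≤ (∑ w ∈ P, (bad w).card) * M :=
            Nat.mul_le_mul_right _ Finset.card_biUnion_le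
        _ = ∑ w ∈ P, (bad w).card * M := Finset.sum_mul _ _ _
        _ ≤ ∑ w ∈ P, M ^ d := Finset.sum_le_sum fun w _ => hbad w
        _ = _ := by simp
    have h2 : P.card * M ^ d < M ^ d * M := by
      rw [mul_comm]; exact Nat.mul_lt_mul_of_pos_left hP (by positivity)
    rw [hG]
    exact lt_of_mul_lt_mul_right (h1.trans_lt h2) (Nat.zero_le _)
  obtain ⟨u, hu, hnu⟩ := Finset.exists_mem_notMem_of_card_lt_card hlt
  refine ⟨u, fun i => Finset.mem_range.1 (Fintype.mem_piFinset.1 hu i), fun w hw i => ?_⟩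
  by_contra h
  exact hnu (Finset.mem_biUnion.2 ⟨w, hw, Finset.mem_filter.2 ⟨hu, i, not_le.1 h⟩⟩)

theorem IsDeltaSeparated.exists_bounds {d : ℕ} {Δ : ℝ} {X : Set (EuclideanSpace ℝ (Fin d))}
    (hX : IsDeltaSeparated Δ X) (hΔ : 1 ≤ Δ) :
    ∃ δ : ℝ, 0 < δ ∧ ∀ x ∈ X, ∀ x' ∈ X, x ≠ x' → δ ≤ ‖x - x'‖ ∧ ‖x - x'‖ ≤ Δ * δ := by
  by_cases hsub : ∃ x ∈ X, ∃ x' ∈ X, x ≠ x'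
  · unfold IsDeltaSeparated at hX
    set I := ⨅ (x ∈ X) (x' ∈ X) (_ : x ≠ x'), ‖x - x'‖ₑ with hI
    have hle : ∀ x ∈ X, ∀ x' ∈ X, x ≠ x' → I ≤ ‖x - x'‖ₑ := fun x hx x' hx' h =>
      iInf₂_le_of_le x hx (iInf₂_le_of_le x' hx' (iInf_le_of_le h le_rfl))
    have hge : ∀ x ∈ X, ∀ x' ∈ X, x ≠ x' →
        ‖x - x'‖ₑ ≤ ⨆ (x ∈ X) (x' ∈ X) (_ : x ≠ x'), ‖x - x'‖ₑ := fun x hx x' hx' h =>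
      le_iSup₂_of_le x hx (le_iSup₂_of_le x' hx' (le_iSup_of_le h le_rfl))
    have h0 : I ≠ 0 := by
      intro h
      rw [h, mul_zero] at hX
      exact not_lt_bot hX
    have htop : I ≠ ⊤ := by
      obtain ⟨x, hx, x', hx', h⟩ := hsub
      exact ((hle x hx x' hx' h).trans_lt enorm_lt_top).ne
    refine ⟨I.toReal, ENNReal.toReal_pos h0 htop, fun x hx x' hx' h => ⟨?_, ?_⟩⟩
    · rw [← toReal_enorm]
      exact ENNReal.toReal_mono enorm_ne_top (hle x hx x' hx' h)
    · have := ENNReal.toReal_mono (ENNReal.mul_ne_top ENNReal.ofReal_ne_top htop)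
        ((hge x hx x' hx' h).trans hX.le)
      rwa [toReal_enorm, ENNReal.toReal_mul, ENNReal.toReal_ofReal (by linarith)] at this
  · exact ⟨1, one_pos, fun x hx x' hx' h => absurd ⟨x, hx, x', hx', h⟩ hsub⟩

/-- A linear projection to the line that keeps the points apart. -/
theorem IsDeltaSeparated.exists_projection {d : ℕ} (hd : 0 < d) {Δ : ℝ} (hΔ : 1 ≤ Δ)
    {X : Set (EuclideanSpace ℝ (Fin d))} [Fintype X] [Nonempty X] (hX : IsDeltaSeparated Δ X) :
    ∃ (a : Fin d → ℝ) (b : ℝ) (f : X → ℝ), (∀ x, f x = ∑ i, a i * x.1 i + b) ∧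
      (∀ x, 0 ≤ f x) ∧ (∀ x, f x < 3 * (Fintype.card X : ℝ) ^ 2 * d ^ 2 * Δ) ∧
      ∀ x x', x ≠ x' → 1 ≤ |f x - f x'| := by
  classical
  obtain ⟨δ, hδ, hb⟩ := hX.exists_bounds hΔ
  set N := Fintype.card X
  have hN : 0 < N := Fintype.card_pos
  set P : Finset (Fin d → ℝ) := (Finset.univ : Finset X).offDiag.image
    fun q => fun i => q.1.1 i - q.2.1 i
  have hP : P.card < N * N := by
    refine Finset.card_image_le.trans_lt ?_
    rw [Finset.offDiag_card, Finset.card_univ]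
    exact Nat.sub_lt (Nat.mul_pos hN hN) hN
  obtain ⟨u, huM, hu⟩ := exists_nat_functional hd P (N * N) hP
  have hdR : (0 : ℝ) < d := by exact_mod_cast hd
  have hmem : ∀ x x' : X, x ≠ x' → (fun i => x.1 i - x'.1 i) ∈ P := fun x x' h =>
    Finset.mem_image.2 ⟨(x, x'), by simpa using h, rfl⟩
  -- The Euclidean norm is at most the sum of `d` coordinate moduli, each at most twice the value of
  -- the functional; the factor `2 * d / δ` turns the distance `δ` into a gap of 1.
  set F : X → ℝ := fun x => ∑ i, (2 * d / δ * u i) * x.1 i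
  have hF : ∀ x x', F x - F x' = 2 * d / δ * ∑ i, (u i : ℝ) * (x.1 i - x'.1 i) := by
    intro x x'
    simp only [F]
    rw [← Finset.sum_sub_distrib, Finset.mul_sum]
    exact Finset.sum_congr rfl fun i _ => by ring
  have hlow : ∀ x x', x ≠ x' → 1 ≤ |F x - F x'| := by
    intro x x' h
    have h1 := (hb x x.2 x' x'.2 (Subtype.coe_injective.ne h)).1
    have h2 : ‖x.1 - x'.1‖ ≤ ∑ i, |x.1 i - x'.1 i| := by
      refine le_of_sq_le_sq ?_ (Finset.sum_nonneg fun i _ => abs_nonneg _)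
      rw [EuclideanSpace.norm_sq_eq]
      exact Finset.sum_sq_le_sq_sum_of_nonneg fun i _ => abs_nonneg _
    have h3 : ∑ i, |x.1 i - x'.1 i| ≤ d * (2 * |∑ i, (u i : ℝ) * (x.1 i - x'.1 i)|) := by
      refine (Finset.sum_le_card_nsmul _ _ _ fun i _ => hu _ (hmem x x' h) i).trans ?_
      simp
    rw [hF, abs_mul, abs_of_pos (by positivity : 0 < 2 * d / δ), div_mul_eq_mul_div,
      le_div_iff₀ hδ]
    linarith
  have hup : ∀ x x', F x - F x' ≤ 2 * (N : ℝ) ^ 2 * d ^ 2 * Δ := by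
    intro x x'
    by_cases h : x = x'
    · subst h; rw [sub_self]; positivity
    have h1 := (hb x x.2 x' x'.2 (Subtype.coe_injective.ne h)).2
    have h3 : ∑ i, (u i : ℝ) * (x.1 i - x'.1 i) ≤ d * ((N : ℝ) ^ 2 * (Δ * δ)) := by
      refine (Finset.sum_le_card_nsmul _ _ ((N : ℝ) ^ 2 * (Δ * δ)) fun i _ => ?_).trans ?_
      · have h4 : x.1 i - x'.1 i ≤ Δ * δ :=
          ((le_abs_self _).trans (PiLp.norm_apply_le (x.1 - x'.1) i)).trans h1
        have h5 : (u i : ℝ) ≤ (N : ℝ) ^ 2 := by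
          rw [sq]; exact_mod_cast (huM i).le
        have : 0 ≤ Δ * δ := by positivity
        calc (u i : ℝ) * (x.1 i - x'.1 i) ≤ u i * (Δ * δ) := by gcongr
          _ ≤ _ := by gcongr
      · simp
    rw [hF]
    calc 2 * d / δ * ∑ i, (u i : ℝ) * (x.1 i - x'.1 i)
        ≤ 2 * d / δ * (d * ((N : ℝ) ^ 2 * (Δ * δ))) := by gcongr
      _ = _ := by field_simp
  obtain ⟨x₀, hx₀⟩ := Finite.exists_min F
  refine ⟨fun i => 2 * d / δ * u i, -F x₀, fun x => F x - F x₀, fun x => by simp [F]; ring,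
    fun x => sub_nonneg.2 (hx₀ x), fun x => (hup x x₀).trans_lt ?_, fun x x' h => ?_⟩
  · have : (0 : ℝ) < (N : ℝ) ^ 2 * d ^ 2 * Δ := by
      have : (0 : ℝ) < N := by exact_mod_cast hN
      positivity
    linarith
  · simpa using hlow x x' h

/-! ### Folding separated points of a line -/

section Fold

variable {X : Type*} [Fintype X]

/-- Blocks of at most `n` separated points can be shifted by even integers at most `2 n |X|` so that
all points become separated. -/
theorem exists_separating_shift (r : X → ℝ) (κ : X → ℕ) (n : ℕ)
    (hn : ∀ i, (Finset.univ.filter fun x => κ x = i).card ≤ n)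
    (hsep : ∀ x x', κ x = κ x' → x ≠ x' → 1 ≤ |r x - r x'|) :
    ∃ t : ℕ → ℕ, (∀ i, t i ≤ n * Fintype.card X) ∧
      ∀ x x', x ≠ x' → 1 ≤ |(r x + 2 * t (κ x)) - (r x' + 2 * t (κ x'))| := by
  classical
  have key : ∀ m : ℕ, ∃ t : ℕ → ℕ, (∀ i, t i ≤ n * Fintype.card X) ∧
      ∀ x x', x ≠ x' → κ x < m → κ x' < m →
        1 ≤ |(r x + 2 * t (κ x)) - (r x' + 2 * t (κ x'))| := by
    intro m
    induction m with
    | zero => exact ⟨0, by simp, by simp⟩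
    | succ m ih =>
      obtain ⟨t, ht, hts⟩ := ih
      set R := Finset.range (n * Fintype.card X + 1)
      -- The shifts are chosen greedily, block by block. A collision confines `2 * s` to an open
      -- interval of length 2, so each of the at most `n * |X|` pairs excludes at most one of the `n
      -- * |X| + 1` candidates.
      set bad : X × X → Finset ℕ := fun q =>
        R.filter fun s => |(r q.1 + 2 * (s : ℝ)) - (r q.2 + 2 * t (κ q.2))| < 1
      have hbad : ∀ q ∈ (Finset.univ.filter fun x => κ x = m) ×ˢ (Finset.univ : Finset X),
          (bad q).card ≤ 1 := by
        intro q _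
        refine Finset.card_le_one.2 fun s hs s' hs' => ?_
        have h1 := abs_lt.1 (Finset.mem_filter.1 hs).2
        have h2 := abs_lt.1 (Finset.mem_filter.1 hs').2
        have h3 : (s : ℝ) < s' + 1 := by linarith
        have h4 : (s' : ℝ) < s + 1 := by linarith
        have h5 : s < s' + 1 := by exact_mod_cast h3
        have h6 : s' < s + 1 := by exact_mod_cast h4
        omega
      have hlt : (((Finset.univ.filter fun x => κ x = m) ×ˢ
          (Finset.univ : Finset X)).biUnion bad).card < R.card := by
        refine (Finset.card_biUnion_le_card_mul _ _ 1 hbad).trans_lt ?_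
        rw [Finset.card_product, Finset.card_univ, mul_one, Finset.card_range]
        exact Nat.lt_succ_of_le (Nat.mul_le_mul_right _ (hn m))
      obtain ⟨s, hs, hns⟩ := Finset.exists_mem_notMem_of_card_lt_card hlt
      have hgood : ∀ x x', κ x = m → 1 ≤ |(r x + 2 * (s : ℝ)) - (r x' + 2 * t (κ x'))| := by
        intro x x' hx
        by_contra h
        exact hns (Finset.mem_biUnion.2 ⟨(x, x'), by simpa using hx,
          Finset.mem_filter.2 ⟨hs, not_le.1 h⟩⟩)
      refine ⟨Function.update t m s, fun i => ?_, fun x x' hne hx hx' => ?_⟩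
      · by_cases hi : i = m
        · subst hi
          simpa using Nat.lt_succ_iff.1 (Finset.mem_range.1 hs)
        · simpa [hi] using ht i
      · by_cases h : κ x = m
        · by_cases h' : κ x' = m
          · rw [h, h']
            simpa using hsep x x' (h.trans h'.symm) hne
          · rw [h, Function.update_self, Function.update_of_ne h']
            exact hgood x x' h
        · by_cases h' : κ x' = m
          · rw [h', Function.update_self, Function.update_of_ne h, abs_sub_comm]
            exact hgood x' x h'
          · rw [Function.update_of_ne h, Function.update_of_ne h']
            exact hts x x' hne (by omega) (by omega)
  obtain ⟨b, hb⟩ := (Set.finite_range κ).bddAbove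
  obtain ⟨t, ht, hts⟩ := key (b + 1)
  exact ⟨t, ht, fun x x' h => hts x x' h (Nat.lt_succ_of_le (hb ⟨x, rfl⟩))
    (Nat.lt_succ_of_le (hb ⟨x', rfl⟩))⟩

/-- Folding separated points of the half-line into the interval `[0, L + 2 n |X|)` by a translation
on each of few blocks of consecutive points. -/
theorem exists_fold (f : X → ℝ) {L : ℝ} (hL : 0 < L) {n : ℕ} (hn : 0 < n) (hf : ∀ x, 0 ≤ f x)
    (hsep : ∀ x x', x ≠ x' → 1 ≤ |f x - f x'|) :
    ∃ (κ : X → ℕ) (E : ℕ → ℝ), (∀ x x', κ x < κ x' → f x < f x') ∧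
      (∀ x, κ x ≤ (Fintype.card X - 1) / n + ⌊f x / L⌋₊) ∧
      (∀ x, 0 ≤ f x + E (κ x)) ∧ (∀ x, f x + E (κ x) < L + 2 * n * Fintype.card X) ∧
      ∀ x x', x ≠ x' → 1 ≤ |(f x + E (κ x)) - (f x' + E (κ x'))| := by
  classical
  set rank : X → ℕ := fun x => (Finset.univ.filter fun x' => f x' < f x).card
  have hrank_lt : ∀ x, rank x < Fintype.card X := fun x =>
    Finset.card_lt_univ_of_notMem (x := x) (by simp)
  have hrank_mono : ∀ x x', f x ≤ f x' → rank x ≤ rank x' := fun x x' h =>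
    Finset.card_le_card fun z hz => by
      simp only [Finset.mem_filter, Finset.mem_univ, true_and] at hz ⊢
      exact hz.trans_le h
  have hrank_strict : ∀ x x', f x < f x' → rank x < rank x' := fun x x' h =>
    Finset.card_lt_card ⟨fun z hz => by
      simp only [Finset.mem_filter, Finset.mem_univ, true_and] at hz ⊢
      exact hz.trans h, fun hsub => by
      have : x ∈ Finset.univ.filter fun x' => f x' < f x := hsub (by simpa using h)
      simp at this⟩
  have hrank_inj : Function.Injective rank := by
    intro x x' h
    by_contra hne
    have h1 := hsep x x' hne
    rcases lt_trichotomy (f x) (f x') with h2 | h2 | h2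
    · exact (hrank_strict _ _ h2).ne h
    · rw [h2, sub_self, abs_zero] at h1
      linarith
    · exact (hrank_strict _ _ h2).ne' h
  -- Both summands are nondecreasing along the line, so equality of the sums forces equality of
  -- both: a block has at most `n` points and lies in one interval of length `L`.
  set κ : X → ℕ := fun x => rank x / n + ⌊f x / L⌋₊
  have hfl_mono : ∀ x x', f x ≤ f x' → ⌊f x / L⌋₊ ≤ ⌊f x' / L⌋₊ := fun x x' h =>
    Nat.floor_mono (by gcongr)
  have hκ_eq : ∀ x x', κ x = κ x' → rank x / n = rank x' / n ∧ ⌊f x / L⌋₊ = ⌊f x' / L⌋₊ := by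
    intro x x' h
    simp only [κ] at h
    rcases le_total (f x) (f x') with h1 | h1
    · have := Nat.div_le_div_right (c := n) (hrank_mono _ _ h1)
      have := hfl_mono _ _ h1
      omega
    · have := Nat.div_le_div_right (c := n) (hrank_mono _ _ h1)
      have := hfl_mono _ _ h1
      omega
  have hcount : ∀ i, (Finset.univ.filter fun x => κ x = i).card ≤ n := by
    intro i
    rcases (Finset.univ.filter fun x => κ x = i).eq_empty_or_nonempty with h | ⟨x₀, hx₀⟩
    · simp [h]
    · have hx₀ : κ x₀ = i := by simpa using hx₀
      calc (Finset.univ.filter fun x => κ x = i).card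
          ≤ (Finset.Ico (n * (rank x₀ / n)) (n * (rank x₀ / n) + n)).card := by
            refine Finset.card_le_card_of_injOn rank ?_ hrank_inj.injOn
            intro x hx
            have hx : κ x = i := by simpa using hx
            have h1 := (hκ_eq x x₀ (hx.trans hx₀.symm)).1
            rw [← h1]
            simp only [Finset.coe_Ico, Set.mem_Ico]
            exact ⟨Nat.mul_div_le _ _, Nat.lt_mul_div_succ _ hn⟩
        _ = n := by simp
  have hbase : ∀ i, ∃ c : ℕ, ∀ x, κ x = i → ⌊f x / L⌋₊ = c := by
    intro i
    by_cases h : ∃ x₀, κ x₀ = i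
    · obtain ⟨x₀, hx₀⟩ := h
      exact ⟨⌊f x₀ / L⌋₊, fun x hx => (hκ_eq x x₀ (hx.trans hx₀.symm)).2⟩
    · exact ⟨0, fun x hx => absurd ⟨x, hx⟩ h⟩
  choose c hc using hbase
  have hr0 : ∀ x, 0 ≤ f x - L * c (κ x) := by
    intro x
    rw [← hc (κ x) x rfl]
    have := Nat.floor_le (div_nonneg (hf x) hL.le)
    rw [le_div_iff₀ hL] at this
    linarith
  have hrL : ∀ x, f x - L * c (κ x) < L := by
    intro x
    rw [← hc (κ x) x rfl]
    have := Nat.lt_floor_add_one (f x / L)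
    rw [div_lt_iff₀ hL] at this
    linarith
  obtain ⟨t, ht, hts⟩ := exists_separating_shift (fun x => f x - L * c (κ x)) κ n hcount (by
    intro x x' h hne
    simpa [h] using hsep x x' hne)
  refine ⟨κ, fun i => 2 * t i - L * c i, fun x x' h => ?_, fun x => ?_, fun x => ?_, fun x => ?_,
    fun x x' hne => ?_⟩
  · by_contra hle
    have h1 := Nat.div_le_div_right (c := n) (hrank_mono _ _ (not_lt.1 hle))
    have h2 := hfl_mono _ _ (not_lt.1 hle)
    simp only [κ] at h
    omega
  · have := Nat.div_le_div_right (c := n) (Nat.le_sub_one_of_lt (hrank_lt x))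
    simp only [κ]
    omega
  · have := hr0 x
    have : (0 : ℝ) ≤ t (κ x) := Nat.cast_nonneg _
    linarith
  · have h1 := hrL x
    have h2 : (t (κ x) : ℝ) ≤ n * Fintype.card X := by exact_mod_cast ht (κ x)
    linarith
  · have := hts x x' hne
    rw [show f x + (2 * (t (κ x) : ℝ) - L * c (κ x)) - (f x' + (2 * t (κ x') - L * c (κ x')))
      = f x - L * c (κ x) + 2 * t (κ x) - (f x' - L * c (κ x') + 2 * t (κ x')) by ring]
    exact this

end Fold

/-! ### Assembling the layers -/

section Assembly

variable {σ : ℝ → ℝ} {d : ℕ} {X : Type*} {ξ : X → Fin d → ℝ} {k : ℕ}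

/-- `f` is nonnegative and its values are at distance at least `1` from each other. -/
def Spread (f : X → ℝ) : Prop :=
  (∀ x, 0 ≤ f x) ∧ ∀ x x', x ≠ x' → 1 ≤ |f x - f x'|

theorem Reach.fold [Fintype X] (hσ : IsSigmoidal σ) {f : X → ℝ} (hf : Spread f)
    (h : Reach σ ξ k (fun x => ![f x, 0, 0])) {L : ℝ} (hL : 0 < L) {n : ℕ} (hn : 0 < n) (m : ℕ)
    (hm : ∀ x, (Fintype.card X - 1) / n + ⌊f x / L⌋₊ ≤ m) :
    ∃ g : X → ℝ, Spread g ∧ (∀ x, g x < L + 2 * n * Fintype.card X) ∧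
      Reach σ ξ (k + m) (fun x => ![g x, 0, 0]) := by
  obtain ⟨κ, E, hmono, hκ, h0, hlt, hsep⟩ := exists_fold f hL hn hf.1 hf.2
  refine ⟨fun x => f x + E (κ x), ⟨h0, hsep⟩, hlt, ?_⟩
  have h1 := h.add_block hσ 0 κ E (fun x x' i hi hi' => by
    simpa using hmono x x' (hi.trans_lt hi')) m (fun x => (hκ x).trans (hm x))
  exact h1.affine₃ !![1, 1, 0; 0, 0, 0; 0, 0, 0] 0 (by simp) (by simp) (by simp)

/-- A fold with one cut maps length `D'` to `D' / 2 + 2 * N ^ 2`, where `N = |X|`; the fixed point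
of this map is `4 * N ^ 2`. -/
theorem Reach.halve [Fintype X] [Nonempty X] (hσ : IsSigmoidal σ) {f : X → ℝ} (hf : Spread f)
    (h : Reach σ ξ k (fun x => ![f x, 0, 0])) {D : ℝ} (hD : ∀ x, f x < D) (T : ℕ) :
    ∃ g : X → ℝ, Spread g ∧ (∀ x, g x < D / 2 ^ T + 4 * (Fintype.card X : ℝ) ^ 2) ∧
      Reach σ ξ (k + T) (fun x => ![g x, 0, 0]) := by
  have hN : 0 < Fintype.card X := Fintype.card_pos
  have hNR : (0 : ℝ) < Fintype.card X := by exact_mod_cast hN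
  have hD0 : 0 < D := (hf.1 (Classical.arbitrary X)).trans_lt (hD _)
  induction T with
  | zero =>
    refine ⟨f, hf, fun x => ?_, h⟩
    have := hD x
    rw [pow_zero, div_one]
    have : 0 < 4 * (Fintype.card X : ℝ) ^ 2 := by positivity
    linarith
  | succ T ih =>
    obtain ⟨g, hg, hlt, hr⟩ := ih
    set D' := D / 2 ^ T + 4 * (Fintype.card X : ℝ) ^ 2
    have hD' : 0 < D' := by positivity
    -- With block capacity `|X|` the rank causes no cut; only the midpoint does.
    obtain ⟨g', hg', hlt', hr'⟩ := hr.fold hσ hg (half_pos hD') hN 1 (by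
      intro x
      rw [Nat.div_eq_of_lt (by omega), zero_add, ← Nat.lt_succ_iff, Nat.floor_lt
        (div_nonneg (hg.1 x) (half_pos hD').le), div_lt_iff₀ (half_pos hD')]
      have := hlt x
      push_cast
      linarith)
    refine ⟨g', hg', fun x => (hlt' x).trans_eq ?_, hr'⟩
    simp only [D', pow_succ]
    field_simp
    ring

/-- Separated points of a short interval are memorized by reading off the label of each
unit cell. -/
theorem Reach.read_label [Fintype X] (hσ : IsSigmoidal σ) {f : X → ℝ} (hf : Spread f)
    (h : Reach σ ξ k (fun x => ![f x, 0, 0])) {n : ℕ} (hn : 0 < n) (m B : ℕ)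
    (hm : ∀ x, f x < n * (m + 1)) (y : X → ℕ) (hy : ∀ x, y x < 2 ^ B) :
    ∃ p : X → ℝ, Reach σ ξ (k + m + 4 * n * B) (fun x => ![p x, y x, 0]) := by
  classical
  have hnR : (0 : ℝ) < n := by exact_mod_cast hn
  set κ : X → ℕ := fun x => ⌊f x / n⌋₊
  set p : X → ℝ := fun x => f x - n * κ x
  have hp0 : ∀ x, 0 ≤ p x := by
    intro x
    have := Nat.floor_le (div_nonneg (hf.1 x) hnR.le)
    rw [le_div_iff₀ hnR] at this
    simp only [p, κ]
    linarith
  have hpn : ∀ x, p x < n := by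
    intro x
    have := Nat.lt_floor_add_one (f x / n)
    rw [div_lt_iff₀ hnR] at this
    simp only [p, κ]
    linarith
  have hκm : ∀ x, κ x ≤ m := by
    intro x
    rw [← Nat.lt_succ_iff, Nat.floor_lt (div_nonneg (hf.1 x) hnR.le), div_lt_iff₀ hnR]
    push_cast
    linarith [hm x]
  have hinj : ∀ x x', κ x = κ x' → ⌊p x⌋₊ = ⌊p x'⌋₊ → x = x' := by
    intro x x' h1 h2
    by_contra hne
    have h3 := hf.2 x x' hne
    have h4 : f x - f x' = p x - p x' := by simp only [p, h1]; ring
    rw [h4] at h3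
    have a1 := Nat.floor_le (hp0 x)
    have a2 := Nat.lt_floor_add_one (p x)
    have a3 := Nat.floor_le (hp0 x')
    have a4 := Nat.lt_floor_add_one (p x')
    rw [h2] at a1 a2
    have : |p x - p x'| < 1 := abs_lt.2 ⟨by linarith, by linarith⟩
    linarith
  -- A unit cell contains at most one point, so its label is well defined; empty cells get 0.
  set Y : ℕ → ℕ → ℕ := fun i j =>
    if h : ∃ x, κ x = i ∧ ⌊p x⌋₊ = j then y h.choose else 0
  have hY : ∀ i j, Y i j < 2 ^ B := by
    intro i j
    simp only [Y]
    split_ifs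
    · exact hy _
    · positivity
  have hYx : ∀ x, Y (κ x) ⌊p x⌋₊ = y x := by
    intro x
    have h : ∃ x', κ x' = κ x ∧ ⌊p x'⌋₊ = ⌊p x⌋₊ := ⟨x, rfl, rfl⟩
    simp only [Y]
    rw [dif_pos h, hinj _ _ h.choose_spec.1 h.choose_spec.2]
  obtain ⟨e, he⟩ := exists_readout (ξ := ξ) hσ κ n B hp0 hpn Y hY
  have h1 := h.add_block hσ (-n) κ e (fun x x' i hi hi' => by
    have h2 := hpn x
    have h3 := hp0 x'
    simp only [p] at h2 h3
    have h4 : (i : ℝ) + 1 ≤ κ x' := by exact_mod_cast hi'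
    have h5 : (n : ℝ) * (i + 1) ≤ n * κ x' := by gcongr
    linarith) m hκm
  have h2 := he (k + m) _ (h1.eq (V := fun x => ![p x, e (κ x), 0]) (by
    funext x
    simp only [p, zero_add]
    congr 1
    ring))
  exact ⟨p, h2.eq (by simp only [hYx])⟩

/-- With `a` about `N ^ (1 / 3)`, halving leaves length at most `5 * a ^ 6`. Folding into blocks of
length `a ^ 4` with at most `a` points takes at most `a ^ 2 + 5 * a ^ 2` cuts and leaves length at
most `a ^ 4 + 2 * a * a ^ 3 = 3 * a ^ 4`, which is read in blocks of `a ^ 2` cells. -/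
theorem Reach.memorize [Fintype X] [Nonempty X] (hσ : IsSigmoidal σ) {f : X → ℝ} (hf : Spread f)
    (h : Reach σ ξ k (fun x => ![f x, 0, 0])) {T a B : ℕ}
    (hD : ∀ x, f x < 2 ^ T * (Fintype.card X : ℝ) ^ 2) (ha : Fintype.card X ≤ a ^ 3)
    (y : X → ℕ) (hy : ∀ x, y x < 2 ^ B) :
    ∃ p : X → ℝ, Reach σ ξ (k + T + 6 * a ^ 2 + 3 * a ^ 2 + 4 * a ^ 2 * B)
      (fun x => ![p x, y x, 0]) := by
  have hN : 0 < Fintype.card X := Fintype.card_pos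
  have ha0 : 0 < a := by
    rcases Nat.eq_zero_or_pos a with rfl | h
    · simp at ha
    · exact h
  have haR : (0 : ℝ) < a := by exact_mod_cast ha0
  have hNa : (Fintype.card X : ℝ) ≤ a ^ 3 := by exact_mod_cast ha
  obtain ⟨g₁, hg₁, hlt₁, hr₁⟩ := h.halve hσ hf hD T
  have hb₁ : ∀ x, g₁ x < 5 * a ^ 6 := by
    intro x
    refine (hlt₁ x).trans_le ?_
    rw [mul_div_cancel_left₀ _ (by positivity)]
    have : (Fintype.card X : ℝ) ^ 2 ≤ (a ^ 3) ^ 2 := by gcongr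
    rw [← pow_mul] at this
    norm_num at this
    linarith
  obtain ⟨g₂, hg₂, hlt₂, hr₂⟩ := hr₁.fold hσ hg₁ (L := (a : ℝ) ^ 4) (by positivity) ha0
    (6 * a ^ 2) (by
      intro x
      have h1 : (Fintype.card X - 1) / a ≤ a ^ 2 := by
        refine Nat.div_le_of_le_mul ?_
        calc Fintype.card X - 1 ≤ a ^ 3 := (Nat.sub_le _ _).trans ha
          _ = a * a ^ 2 := by ring
      have h2 : ⌊g₁ x / (a : ℝ) ^ 4⌋₊ ≤ 5 * a ^ 2 := by
        refine Nat.floor_le_of_le ?_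
        rw [div_le_iff₀ (by positivity)]
        push_cast
        calc g₁ x ≤ 5 * a ^ 6 := (hb₁ x).le
          _ = _ := by ring
      omega)
  obtain ⟨p, hp⟩ := hr₂.read_label hσ hg₂ (n := a ^ 2) (by positivity) (3 * a ^ 2) B (by
    intro x
    refine (hlt₂ x).trans_le ?_
    push_cast
    have : 2 * (a : ℝ) * Fintype.card X ≤ 2 * a * a ^ 3 := by gcongr
    have : (0 : ℝ) < a ^ 2 := by positivity
    nlinarith) y hy
  exact ⟨p, hp⟩

theorem reach_zero {f : X → ℝ} (a : Fin d → ℝ) (b : ℝ) (hf : ∀ x, f x = ∑ i, a i * ξ x i + b) :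
    Reach σ ξ 0 (fun x => ![f x, 0, 0]) := by
  refine subset_closure ⟨⟨Matrix.of ![a, 0, 0], ![b, 0, 0]⟩, ?_⟩
  funext x i
  fin_cases i <;> simp [AffineParams.apply, dotProduct, hf]

/-- Memorization by `K` hidden layers of three neurons, with an explicit sufficient depth. -/
theorem canMemorize_of_le (hσ : IsSigmoidal σ) (hd : 0 < d) {Δ : ℝ} (hΔ : 1 ≤ Δ) {C N : ℕ}
    (hN : 0 < N) {T a B K : ℕ} (hT : 3 * (d : ℝ) ^ 2 * Δ ≤ 2 ^ T) (ha : N ≤ a ^ 3)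
    (hB : C ≤ 2 ^ B) (hK : T + 9 * a ^ 2 + 4 * a ^ 2 * B ≤ K)
    (X : Set (EuclideanSpace ℝ (Fin d))) (hX : X.encard = (N : ℕ∞)) (hsep : IsDeltaSeparated Δ X)
    (y : X → Fin C) : CanMemorize σ (List.replicate K 3) X y := by
  have hfin : X.Finite := Set.finite_of_encard_eq_coe hX
  have : Fintype X := hfin.fintype
  have hcard : Fintype.card X = N := by
    rw [← Nat.card_eq_fintype_card, Nat.card_coe_set_eq, Set.ncard_def, hX]
    rfl
  have : Nonempty X := Fintype.card_pos_iff.1 (hcard ▸ hN)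
  obtain ⟨w, b, f, hfe, hf0, hflt, hfs⟩ := hsep.exists_projection hd hΔ
  have h0 : Reach σ (fun x : X => fun i => x.1 i) 0 (fun x => ![f x, 0, 0]) := reach_zero w b hfe
  obtain ⟨p, hp⟩ := h0.memorize hσ ⟨hf0, hfs⟩ (T := T) (a := a) (B := B) (by
    intro x
    refine (hflt x).trans_le ?_
    calc 3 * (Fintype.card X : ℝ) ^ 2 * d ^ 2 * Δ
        = (3 * (d : ℝ) ^ 2 * Δ) * (Fintype.card X : ℝ) ^ 2 := by ring
      _ ≤ _ := by gcongr) (hcard ▸ ha) (fun x => (y x : ℕ)) (fun x => (y x).2.trans_le hB)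
  intro ε hε
  exact (hp.mono hσ (l := K) (by omega)).exists_netEval 1 hε

theorem exists_netEval_eq_zero (σ : ℝ → ℝ) (ds : List ℕ) (d : ℕ) :
    ∃ θ : NetParams d ds, ∀ x, netEval σ d ds θ x = 0 := by
  induction ds generalizing d with
  | nil =>
    refine ⟨(⟨0, 0⟩ : AffineParams d 1), fun x => ?_⟩
    change (⟨0, 0⟩ : AffineParams d 1).apply x 0 = 0
    simp [AffineParams.apply]
  | cons e ds ih =>
    obtain ⟨θ, hθ⟩ := ih e
    exact ⟨((⟨0, 0⟩ : AffineParams d e), θ), fun x => hθ _⟩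

theorem canMemorize_of_le_one {C : ℕ} (hC : C ≤ 1) (ds : List ℕ)
    (X : Set (EuclideanSpace ℝ (Fin d))) (y : X → Fin C) : CanMemorize σ ds X y := by
  intro ε hε
  obtain ⟨θ, hθ⟩ := exists_netEval_eq_zero σ ds d
  refine ⟨θ, fun x => ?_⟩
  have hy : (y x : ℕ) = 0 := by have := (y x).2; omega
  simp [hθ, hy, hε.le]

end Assembly

/-! ### Choice of parameters and conclusion -/

/-- The number of halvings and the block size for given parameters. -/
theorem exists_parameters {C N d : ℕ} {Δ : ℝ} (hC : 2 ≤ C) (hN : 0 < N) (hd : 0 < d) (hΔ : 1 ≤ Δ) :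
    ∃ T a B : ℕ, 3 * (d : ℝ) ^ 2 * Δ ≤ 2 ^ T ∧ N ≤ a ^ 3 ∧ C ≤ 2 ^ B ∧
      ((T + 9 * a ^ 2 + 4 * a ^ 2 * B : ℕ) : ℝ) ≤ 100 * max 1 (depthScale C N d Δ) := by
  have hdR : (1 : ℝ) ≤ d := by exact_mod_cast hd
  have hNR : (1 : ℝ) ≤ N := by exact_mod_cast hN
  have hCR : (2 : ℝ) ≤ C := by exact_mod_cast hC
  set ld := Real.logb 2 d
  set lΔ := Real.logb 2 Δ
  set lC := Real.logb 2 C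
  have hld : 0 ≤ ld := Real.logb_nonneg (by norm_num) hdR
  have hlΔ : 0 ≤ lΔ := Real.logb_nonneg (by norm_num) hΔ
  have hlC : 1 ≤ lC := by
    rw [Real.le_logb_iff_rpow_le (by norm_num) (by linarith)]
    simpa using hCR
  set c := (N : ℝ) ^ (1 / 3 : ℝ)
  have hc : 1 ≤ c := Real.one_le_rpow hNR (by norm_num)
  have hc3 : c ^ 3 = N := by
    rw [← Real.rpow_natCast, ← Real.rpow_mul (by positivity)]
    norm_num
  have hc2 : c ^ 2 = (N : ℝ) ^ (2 / 3 : ℝ) := by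
    rw [← Real.rpow_natCast, ← Real.rpow_mul (by positivity)]
    norm_num
  have hT : 3 * (d : ℝ) ^ 2 * Δ ≤ 2 ^ ⌈2 + 2 * ld + lΔ⌉₊ := by
    have h1 : (2 : ℝ) ^ (2 + 2 * ld + lΔ) = 4 * d ^ 2 * Δ := by
      rw [Real.rpow_add (by norm_num), Real.rpow_add (by norm_num), mul_comm 2 ld,
        Real.rpow_mul (by norm_num), Real.rpow_logb (by norm_num) (by norm_num) (by linarith),
        Real.rpow_logb (by norm_num) (by norm_num) (by linarith)]
      norm_num
    calc 3 * (d : ℝ) ^ 2 * Δ ≤ 4 * d ^ 2 * Δ := by gcongr; norm_num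
      _ = (2 : ℝ) ^ (2 + 2 * ld + lΔ) := h1.symm
      _ ≤ (2 : ℝ) ^ ((⌈2 + 2 * ld + lΔ⌉₊ : ℕ) : ℝ) :=
        Real.rpow_le_rpow_of_exponent_le (by norm_num) (Nat.le_ceil _)
      _ = _ := Real.rpow_natCast _ _
  have hB : C ≤ 2 ^ ⌈lC⌉₊ := by
    have : (C : ℝ) ≤ 2 ^ ⌈lC⌉₊ := by
      calc (C : ℝ) = (2 : ℝ) ^ lC :=
            (Real.rpow_logb (by norm_num) (by norm_num) (by linarith)).symm
        _ ≤ (2 : ℝ) ^ ((⌈lC⌉₊ : ℕ) : ℝ) :=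
          Real.rpow_le_rpow_of_exponent_le (by norm_num) (Nat.le_ceil _)
        _ = _ := Real.rpow_natCast _ _
    exact_mod_cast this
  have ha : N ≤ ⌈c⌉₊ ^ 3 := by
    have : (N : ℝ) ≤ (⌈c⌉₊ : ℝ) ^ 3 := by
      rw [← hc3]; gcongr; exact Nat.le_ceil _
    exact_mod_cast this
  refine ⟨_, _, _, hT, ha, hB, ?_⟩
  have hT' : (⌈2 + 2 * ld + lΔ⌉₊ : ℝ) ≤ 3 + 2 * ld + lΔ := by
    have := (Nat.ceil_lt_add_one (by positivity : 0 ≤ 2 + 2 * ld + lΔ)).le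
    linarith
  have ha' : (⌈c⌉₊ : ℝ) ≤ 2 * c := by
    have := (Nat.ceil_lt_add_one (by linarith : 0 ≤ c)).le
    linarith
  have hB' : (⌈lC⌉₊ : ℝ) ≤ 2 * lC := by
    have := (Nat.ceil_lt_add_one (by linarith : 0 ≤ lC)).le
    linarith
  have ha2 : (⌈c⌉₊ : ℝ) ^ 2 ≤ 4 * c ^ 2 := by
    calc (⌈c⌉₊ : ℝ) ^ 2 ≤ (2 * c) ^ 2 := by gcongr
      _ = _ := by ring
  have h1 : (⌈c⌉₊ : ℝ) ^ 2 * ⌈lC⌉₊ ≤ 4 * c ^ 2 * (2 * lC) := by gcongr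
  -- Here `C ≥ 2` enters: the folding cost `9 * a ^ 2`, free of `log C`, is absorbed into the
  -- readout term.
  have h2 : c ^ 2 ≤ c ^ 2 * lC := le_mul_of_one_le_right (by positivity) hlC
  have h3 : (1 : ℝ) ≤ max 1 (depthScale C N d Δ) := le_max_left _ _
  have h4 : ld + lΔ + c ^ 2 * lC ≤ max 1 (depthScale C N d Δ) := by
    rw [hc2]; exact le_max_right _ _
  push_cast
  linarith

theorem netWidth_replicate {K : ℕ} (hK : 0 < K) : netWidth (List.replicate K 3) = 3 := by
  induction K with
  | zero => omega
  | succ K ih =>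
    rcases Nat.eq_zero_or_pos K with rfl | h
    · rfl
    · have := ih h
      simp only [netWidth] at this ⊢
      rw [List.replicate_succ, List.foldr_cons, this]
      rfl

theorem theorem2 :
    ∃ c₁ c₂ : ℝ, 0 < c₁ ∧ 0 < c₂ ∧
      ∀ (C N d : ℕ) (Δ : ℝ) (σ : ℝ → ℝ), 0 < C → 0 < N → 0 < d → 1 ≤ Δ → IsSigmoidal σ →
        ∃ ds : List ℕ,
          c₁ * max 1 (depthScale C N d Δ) ≤ (ds.length : ℝ) ∧
          (ds.length : ℝ) ≤ c₂ * max 1 (depthScale C N d Δ) ∧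
          netWidth ds = 3 ∧ (∀ n ∈ ds, n = 3) ∧
          ∀ X : Set (EuclideanSpace ℝ (Fin d)), X.encard = (N : ℕ∞) → IsDeltaSeparated Δ X →
            ∀ y : X → Fin C, CanMemorize σ ds X y := by
  refine ⟨1, 100, one_pos, by norm_num, fun C N d Δ σ hC hN hd hΔ hσ => ?_⟩
  set q := max 1 (depthScale C N d Δ)
  have hq : 1 ≤ q := le_max_left _ _
  -- Rounding down keeps `K ≤ 100 * q`, and `q ≥ 1` gives `K ≥ q`; any natural number bounded by
  -- `100 * q` is still at most `K`.
  set K := ⌊100 * q⌋₊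
  have hK : 1 * q ≤ K := by
    have := Nat.lt_floor_add_one (100 * q)
    simp only [K]
    linarith
  have hK0 : 0 < K := by
    have : (0 : ℝ) < K := by linarith
    exact_mod_cast this
  refine ⟨List.replicate K 3, by simpa using hK, ?_, netWidth_replicate hK0,
    fun n hn => List.eq_of_mem_replicate hn, ?_⟩
  · rw [List.length_replicate]
    exact Nat.floor_le (by linarith)
  -- For `C = 1` the scale has no `N ^ (2 / 3)` term to pay for folding, but all labels are 0 and
  -- the zero network suffices.
  · rcases Nat.lt_or_ge C 2 with hC2 | hC2
    · exact fun X _ _ y => canMemorize_of_le_one (by omega) _ X y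
    · obtain ⟨T, a, B, hT, ha, hB, hle⟩ := exists_parameters hC2 hN hd hΔ
      exact canMemorize_of_le hσ hd hΔ hN hT ha hB (Nat.le_floor hle)
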